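/- For a permutation $\pi$ of $[m]=\{1,\dots,m\}$, say that $\pi$ avoids $321$ if there are no indices $a<b<c$ with $\pi(a)>\pi(b)>\pi(c)$. For $n\ge 1$ let $\mathrm{Av}^\star_{3n}(321)$ be the set of permutations of $[3n]$ that avoid $321$ and whose cycle decomposition consists only of $3$-cycles (in particular there are no fixed points). Then for all $n\ge 1$, \[ |\mathrm{Av}^\star_{3n}(321)|=\sum_{D\in\mathcal D_n}2^{h(D)}\prod_{i=1}^{n-1}\binom{r_i(D)+s_i(D)}{r_i(D)}, \] where $\mathcal D_n$ is the set of Dyck words of semilength $n$ on $\{x,y\}$, that is, words with $n$ letters $x$ and $n$ letters $y$ in which every initial segment contains at least as many $x$'s as $y$'s; $h(D)$ is the number of nonempty initial segments of $D$ (including $D$ itself) with equally many $x$'s and $y$'s; $r_i(D)$ is the number of $y$'s between the $i$-th $x$ and the $(i+1)$-st $x$ of $D$; and $s_i(D)$ is the number of $x$'s between the $i$-th $y$ and the $(i+1)$-st $y$ of $D$. -/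

import Mathlib

namespace ThreeCycles

/-- `π` avoids the pattern `σ`: no subsequence of the one-line notation of `π`, taken at the
positions `f 0 < f 1 < ⋯ < f (k - 1)`, is in the same relative order as `σ`. -/
def Avoids {m k : ℕ} (π : Equiv.Perm (Fin m)) (σ : Equiv.Perm (Fin k)) : Prop :=
  ¬ ∃ f : Fin k ↪o Fin m, ∀ i j : Fin k, π (f i) < π (f j) ↔ σ i < σ j

/-- The permutations of `3n` points, all of whose cycles are 3-cycles (there are then `n` of
them, and no fixed points), that avoid `σ`. -/
def avStar (n : ℕ) {k : ℕ} (σ : Equiv.Perm (Fin k)) : Set (Equiv.Perm (Fin (3 * n))) :=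
  {π | π.cycleType = Multiset.replicate n 3 ∧ Avoids π σ}

/-- The pattern `321`, as a permutation of three points in one-line notation. -/
def pattern321 : Equiv.Perm (Fin 3) := Fin.revPerm

/-- The number of nonempty initial segments of `D` with equally many letters `x = U`
and `y = D`. -/
def h (D : DyckWord) : ℕ :=
  ((Finset.Icc 1 D.toList.length).filter fun k =>
    (D.toList.take k).count DyckStep.U = (D.toList.take k).count DyckStep.D).card

/-- The number of letters `b` in `w` lying between the `i`-th and the `(i+1)`-st letter `a`
(occurrences numbered from 1), that is, the number of positions `p` holding a `b` such that
exactly `i` letters `a` stand before `p`. -/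
def between (w : List DyckStep) (a b : DyckStep) (i : ℕ) : ℕ :=
  (Finset.univ.filter fun p : Fin w.length =>
    w.get p = b ∧ (w.take p).count a = i).card

/-- The number of `y`'s between the `i`-th and the `(i+1)`-st `x`. -/
def r (D : DyckWord) (i : ℕ) : ℕ := between D.toList DyckStep.U DyckStep.D i

/-- The number of `x`'s between the `i`-th and the `(i+1)`-st `y`. -/
def s (D : DyckWord) (i : ℕ) : ℕ := between D.toList DyckStep.D DyckStep.U i

end ThreeCycles

namespace ThreeCycles

open DyckStep

/-! ### Relative order of letters in a word -/

/-! A fixed-point-free permutation avoids `321` exactly when it is increasing on its excedances and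
on its deficiencies (`avoids_iff_monotone`). List the 3-cycles by increasing minimum and write each
one as a column of minimum, middle and maximum. A cycle is oriented either upwards (0→1→2→0,
excedances in rows 0 and 1) or downwards (0→2→1→0, excedance in row 0 only). Monotonicity then says
three things: the rows increase; rows 0 and 1 interleave in the same way as rows 1 and 2; and two
columns `i < j` of opposite orientation satisfy `f (2, i) < f (1, j)`. See `exists_arrangement` and
its converse `columnPerm_mem_avStar`.

The common interleaving is a Dyck word, since columns increase. An orientation may change only
across a return of this word, so it is one free choice per block between returns, which gives `2 ^
h` (`card_orientations`).

For a fixed Dyck word, an arrangement is a word in 0, 1, 2 whose 0,1-subword and 1,2-subword both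
spell it. The letters 1 are common to both subwords. In the gap after the `i`-th letter 1 there are
`s i` zeros and `r i` twos in arbitrary order, hence the binomial factor
(`shuffles_finite_and_ncard`); the two outer gaps contribute 1 (`gapProduct_self`). -/

/-- The `i`-th letter `x` of `w` stands before the `j`-th letter `y` of `w` (occurrences numbered
from `0`), or there are at most `j` letters `y`. -/
def Precedes {α : Type*} [DecidableEq α] (w : List α) (x : α) (i : ℕ) (y : α) (j : ℕ) : Prop :=
  ∃ p, p <+: w ∧ i < p.count x ∧ p.count y ≤ j

theorem Precedes.mono {α : Type*} [DecidableEq α] {w : List α} {x y : α} {i i' j j' : ℕ}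
    (h : Precedes w x i y j) (hi : i' ≤ i) (hj : j ≤ j') : Precedes w x i' y j' := by
  obtain ⟨p, hp, h₁, h₂⟩ := h
  exact ⟨p, hp, by omega, by omega⟩

/-- A word in two letters is determined by its letter counts and by which `D` stands before
which `U`. -/
theorem eq_of_precedes_iff {u v : List DyckStep} (hU : u.count U = v.count U)
    (hD : u.count D = v.count D)
    (h : ∀ i < u.count D, ∀ j < u.count U, Precedes u D i U j ↔ Precedes v D i U j) : u = v := by
  induction u generalizing v with
  | nil =>
    cases v with
    | nil => rfl
    | cons z v => cases z <;> simp at hU hD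
  | cons z u ih =>
    cases v with
    | nil => cases z <;> simp at hU hD
    | cons z' v =>
      -- The relation at indices 0, 0 detects the first letter; `consU` and `consD` below say that
      -- deleting it merely shifts one index.
      have key : ∀ u v : List DyckStep, Precedes (D :: u) D 0 U 0 ∧ ¬ Precedes (U :: v) D 0 U 0 := by
        refine fun u v => ⟨⟨[D], by simp, by simp, by simp⟩, ?_⟩
        rintro ⟨p, hp, h₁, h₂⟩
        rcases List.prefix_cons_iff.1 hp with rfl | ⟨t, rfl, -⟩ <;> simp at h₁ h₂
      have consU : ∀ (u : List DyckStep) i j,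
          Precedes (U :: u) D i U (j + 1) ↔ Precedes u D i U j := by
        refine fun u i j => ⟨?_, ?_⟩
        · rintro ⟨p, hp, h₁, h₂⟩
          rcases List.prefix_cons_iff.1 hp with rfl | ⟨t, rfl, ht⟩
          · simp at h₁
          · exact ⟨t, ht, by simpa using h₁, by simpa using h₂⟩
        · rintro ⟨p, hp, h₁, h₂⟩
          exact ⟨U :: p, by simpa using hp, by simpa using h₁, by simpa using h₂⟩
      have consD : ∀ (u : List DyckStep) i j,
          Precedes (D :: u) D (i + 1) U j ↔ Precedes u D i U j := by
        refine fun u i j => ⟨?_, ?_⟩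
        · rintro ⟨p, hp, h₁, h₂⟩
          rcases List.prefix_cons_iff.1 hp with rfl | ⟨t, rfl, ht⟩
          · simp at h₁
          · exact ⟨t, ht, by simpa using h₁, by simpa using h₂⟩
        · rintro ⟨p, hp, h₁, h₂⟩
          exact ⟨D :: p, by simpa using hp, by simpa using h₁, by simpa using h₂⟩
      cases z <;> cases z' <;> simp only [List.count_cons_self, List.count_cons_of_ne, ne_eq,
        reduceCtorEq, not_false_eq_true, Nat.add_right_cancel_iff] at hU hD h
      · rw [ih hU hD fun i hi j hj => by
          have := h i hi (j + 1) (by omega)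
          rwa [consU, consU] at this]
      · have := h 0 (by omega) 0 (by omega)
        exact absurd (this.2 (key _ u).1) (key v _).2
      · have := h 0 (by omega) 0 (by omega)
        exact absurd (this.1 (key _ v).1) (key u _).2
      · rw [ih hU hD fun i hi j hj => by
          have := h (i + 1) (by omega) j hj
          rwa [consD, consD] at this]

theorem not_precedes_self (p : DyckWord) (i : ℕ) : ¬ Precedes p.toList D i U i := by
  rintro ⟨q, hq, h₁, h₂⟩
  have := p.count_D_le_count_U q.length
  rw [← List.prefix_iff_eq_take.1 hq] at this
  omega

/-- The returns of a Dyck word are the indices `i` for which the `i`-th `D` stands before the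
`(i+1)`-st `U`. -/
theorem h_eq_card (p : DyckWord) [DecidablePred fun i => Precedes p.toList D i U (i + 1)] :
    h p = ((Finset.range p.semilength).filter
      fun i => Precedes p.toList D i U (i + 1)).card := by
  have hlen : ∀ l : List DyckStep, l.count U + l.count D = l.length := by
    intro l
    induction l with
    | nil => rfl
    | cons z l ih => cases z <;> simp <;> omega
  unfold h
  -- A balanced prefix with `i + 1` letters of each kind corresponds to `i`. Conversely, a prefix
  -- witnessing `Precedes` is balanced, because the ballot condition closes the gap between its two
  -- counts.
  refine Finset.card_bij (fun k _ => (p.toList.take k).count U - 1) ?_ ?_ ?_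
  · intro k hk
    simp only [Finset.mem_filter, Finset.mem_Icc, Finset.mem_range] at hk ⊢
    have h₁ := hlen (p.toList.take k)
    rw [List.length_take, min_eq_left hk.1.2] at h₁
    have h₂ : (p.toList.take k).count U ≤ p.toList.count U :=
      (List.take_sublist _ _).count_le _
    refine ⟨?_, p.toList.take k, List.take_prefix _ _, ?_, ?_⟩
    · unfold DyckWord.semilength; omega
    · omega
    · omega
  · intro k hk k' hk' e
    simp only [Finset.mem_filter, Finset.mem_Icc] at hk hk'
    have h₁ := hlen (p.toList.take k)
    have h₂ := hlen (p.toList.take k')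
    rw [List.length_take, min_eq_left hk.1.2] at h₁
    rw [List.length_take, min_eq_left hk'.1.2] at h₂
    omega
  · intro i hi
    simp only [Finset.mem_filter, Finset.mem_range] at hi
    obtain ⟨-, q, hq, h₁, h₂⟩ := hi
    have h₃ := p.count_D_le_count_U q.length
    have e := List.prefix_iff_eq_take.1 hq
    rw [← e] at h₃
    refine ⟨q.length, ?_, ?_⟩
    · simp only [Finset.mem_filter, Finset.mem_Icc, ← e]
      have := hlen q
      exact ⟨⟨by omega, hq.length_le⟩, by omega⟩
    · simp only [← e]; omega

theorem precedes_last (p : DyckWord) {n : ℕ} (hp : p.semilength = n + 1) :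
    Precedes p.toList D n U (n + 1) :=
  ⟨p.toList, List.prefix_rfl, by rw [← p.semilength_eq_count_D]; omega, hp.le⟩

/-! ### Counting locally constant colourings -/

/-- Encode the last value by whether it agrees with its predecessor: this bit is free where `P`
holds and forced elsewhere. The `+ 1` in the exponent is the choice of the first value. -/
theorem card_bool_eq_off (n : ℕ) (P : ℕ → Prop) [DecidablePred P] :
    Nat.card {t : Fin (n + 1) → Bool // ∀ i : Fin n, ¬ P i → t i.castSucc = t i.succ} =
      2 ^ (((Finset.range n).filter P).card + 1) := by
  induction n with
  | zero => simp
  | succ n ih =>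
    have e : {t : Fin (n + 2) → Bool // ∀ i : Fin (n + 1), ¬ P i → t i.castSucc = t i.succ} ≃
        {t : Fin (n + 1) → Bool // ∀ i : Fin n, ¬ P i → t i.castSucc = t i.succ} ×
          {b : Bool // ¬ P n → b = true} :=
      { toFun := fun t => ⟨⟨fun i => t.1 i.castSucc, fun i hi => by
            simpa using t.2 i.castSucc hi⟩,
          ⟨(t.1 (Fin.last n).castSucc == t.1 (Fin.last (n + 1))), fun hn => by
            simpa using t.2 (Fin.last n) (by simpa using hn)⟩⟩
        invFun := fun t => ⟨Fin.snoc t.1.1 (t.1.1 (Fin.last n) == t.2.1), by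
          intro i hi
          induction i using Fin.lastCases with
          | last =>
            have := t.2.2 (by simpa using hi)
            simp [this]
          | cast i =>
            rw [Fin.succ_castSucc, Fin.snoc_castSucc, Fin.snoc_castSucc]
            exact t.1.2 i (by simpa using hi)⟩
        left_inv := by
          rintro ⟨t, ht⟩
          ext i
          induction i using Fin.lastCases with
          | last => cases h : t (Fin.last (n + 1)) <;>
              cases h' : t (Fin.last n).castSucc <;> simp [h, h']
          | cast i => simp
        right_inv := by
          rintro ⟨⟨t, ht⟩, b, hb⟩
          ext i
          · simp
          · cases b <;> cases h' : t (Fin.last n) <;> simp [h'] }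
    rw [Nat.card_congr e, Nat.card_prod, ih, Finset.range_add_one, Finset.filter_insert]
    by_cases hn : P n
    · have : Nat.card {b : Bool // ¬ P n → b = true} = 2 := by simp [hn]
      rw [this, if_pos hn, Finset.card_insert_of_notMem (by simp)]
      ring
    · have : Nat.card {b : Bool // ¬ P n → b = true} = 1 := by simp [hn]
      rw [this, if_neg hn, mul_one]

/-- The number of ways to choose one of two orientations for each index so that the orientation
only changes at returns of the Dyck word. -/
theorem card_orientations (p : DyckWord) {n : ℕ} (hp : p.semilength = n) (hn : 1 ≤ n) :
    Nat.card {t : Fin n → Bool // ∀ i j, i < j → t i ≠ t j → Precedes p.toList D i U j} =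
      2 ^ h p := by
  classical
  obtain ⟨n, rfl⟩ : ∃ m, n = m + 1 := ⟨n - 1, by omega⟩
  have key : ∀ t : Fin (n + 1) → Bool,
      (∀ i j, i < j → t i ≠ t j → Precedes p.toList D i U j) ↔
      ∀ i : Fin n, ¬ Precedes p.toList D i U (i + 1) → t i.castSucc = t i.succ := by
    refine fun t => ⟨fun H i hi => ?_, fun H i j hij => ?_⟩
    · by_contra hne
      exact hi (H _ _ (Fin.castSucc_lt_succ) hne)
    · contrapose!
      intro hnot
      -- By `Precedes.mono`, a return at some `k` with `i ≤ k < j` would put the `i`-th `D` before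
      -- the `j`-th `U`; so no return occurs there and `t` stays constant.
      have aux : ∀ k : ℕ, (i : ℕ) ≤ k → ∀ hk : k ≤ j, t i = t ⟨k, by omega⟩ := by
        intro k hik
        induction k, hik using Nat.le_induction with
        | base => intro _; rfl
        | succ k hik ih =>
          intro hk
          rw [ih (by omega)]
          exact H ⟨k, by omega⟩ fun hpre => hnot (hpre.mono hik hk)
      exact aux j (le_of_lt hij) le_rfl
  -- The final return, at index `n`, separates no two columns; it accounts for the `+ 1` in the
  -- exponent.
  rw [Nat.card_congr (Equiv.subtypeEquivRight key),
    card_bool_eq_off n fun i => Precedes p.toList D i U (i + 1), h_eq_card p, hp,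
    Finset.range_add_one, Finset.filter_insert, if_pos (precedes_last p hp),
    Finset.card_insert_of_notMem (by simp)]

/-! ### Shuffles -/

theorem between_cons (z : DyckStep) (w : List DyckStep) (a b : DyckStep) (i : ℕ) :
    between (z :: w) a b i = (if z = b ∧ 0 = i then 1 else 0) +
      (if z = a then (if i = 0 then 0 else between w a b (i - 1)) else between w a b i) := by
  unfold between
  simp only [Finset.card_filter, List.length_cons, Fin.sum_univ_succ]
  congr 1
  by_cases hz : z = a
  · subst hz
    rcases i with _ | i <;> simp
  · simp [hz]

/-- The letters `0` and `1`, read as `U` and `D`. -/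
def lowerStep : Fin 3 → Option DyckStep := ![some U, some D, none]

/-- The letters `1` and `2`, read as `U` and `D`. -/
def upperStep : Fin 3 → Option DyckStep := ![none, some U, some D]

/-- The words in three letters whose letters `0, 1` form `u` and whose letters `1, 2` form `v`. -/
def shuffles (u v : List DyckStep) : Set (List (Fin 3)) :=
  {w | w.filterMap lowerStep = u ∧ w.filterMap upperStep = v}

theorem cons_mem_shuffles_zero {w : List (Fin 3)} {u v : List DyckStep} :
    0 :: w ∈ shuffles u v ↔ ∃ u', u = U :: u' ∧ w ∈ shuffles u' v := by
  simp only [shuffles, Set.mem_ofPred_eq, List.filterMap_cons, lowerStep, upperStep]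
  simp
  grind

theorem cons_mem_shuffles_one {w : List (Fin 3)} {u v : List DyckStep} :
    1 :: w ∈ shuffles u v ↔ ∃ u' v', u = D :: u' ∧ v = U :: v' ∧ w ∈ shuffles u' v' := by
  simp only [shuffles, Set.mem_ofPred_eq, List.filterMap_cons, lowerStep, upperStep]
  simp
  grind

theorem cons_mem_shuffles_two {w : List (Fin 3)} {u v : List DyckStep} :
    2 :: w ∈ shuffles u v ↔ ∃ v', v = D :: v' ∧ w ∈ shuffles u v' := by
  simp only [shuffles, Set.mem_ofPred_eq, List.filterMap_cons, lowerStep, upperStep]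
  simp
  grind

theorem nil_mem_shuffles {u v : List DyckStep} : [] ∈ shuffles u v ↔ u = [] ∧ v = [] := by
  simp [shuffles, eq_comm]

/-- The number of interleavings that fill the gaps between consecutive common letters. -/
def gapProduct (u v : List DyckStep) : ℕ :=
  ∏ i ∈ Finset.range (u.count D + 1),
    (between v U D i + between u D U i).choose (between v U D i)

theorem gapProduct_one (u v : List DyckStep) :
    gapProduct (D :: u) (U :: v) = gapProduct u v := by
  simp [gapProduct, Finset.prod_range_succ', between_cons]

theorem between_cons_self_zero (z b : DyckStep) (hz : z ≠ b) (w : List DyckStep) :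
    between (z :: w) z b 0 = 0 := by
  simp [between_cons, hz]

theorem between_cons_other_succ (z a : DyckStep) (hz : z ≠ a) (w : List DyckStep) (i : ℕ) :
    between (z :: w) a z (i + 1) = between w a z (i + 1) := by
  simp [between_cons, hz]

theorem between_cons_other_zero (z a : DyckStep) (hz : z ≠ a) (w : List DyckStep) :
    between (z :: w) a z 0 = between w a z 0 + 1 := by
  simp [between_cons, hz, add_comm]

theorem between_nil (a b : DyckStep) (i : ℕ) : between [] a b i = 0 := by
  simp [between]

/-- An initial gap without twos has only one filling, however many zeros it holds. -/
theorem gapProduct_zero (u v : List DyckStep) (hv : between v U D 0 = 0) :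
    gapProduct (U :: u) v = gapProduct u v := by
  simp [gapProduct, Finset.prod_range_succ', between_cons_other_succ, hv]

theorem gapProduct_two (u v : List DyckStep) (hu : between u D U 0 = 0) :
    gapProduct u (D :: v) = gapProduct u v := by
  simp [gapProduct, Finset.prod_range_succ', between_cons_other_succ, hu]

/-- Pascal's rule in the gap of index 0; the other factors are unchanged. -/
theorem gapProduct_zero_two (u v : List DyckStep) :
    gapProduct (U :: u) (D :: v) = gapProduct u (D :: v) + gapProduct (U :: u) v := by
  simp only [gapProduct, Finset.prod_range_succ', between_cons_other_succ, between_cons_other_zero,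
    ne_eq, reduceCtorEq, not_false_eq_true, List.count_cons_of_ne]
  rw [← mul_add]
  congr 1
  rw [show between v U D 0 + 1 + (between u D U 0 + 1) =
    (between v U D 0 + between u D U 0 + 1) + 1 by ring, Nat.choose_succ_succ, add_comm]
  congr 2; ring

/-- Recursion on the first letter of the shuffle. The heads of `u` and `v` force it, except for
heads `U` and `D`, where both 0 and 2 are possible and the two families are disjoint. -/
theorem shuffles_finite_and_ncard (u v : List DyckStep) (huv : u.count D = v.count U) :
    (shuffles u v).Finite ∧ (shuffles u v).ncard = gapProduct u v := by
  have inj : ∀ a : Fin 3, Function.Injective (List.cons a) := fun a => List.cons_injective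
  have step : ∀ {s t : Set (List (Fin 3))} {k : ℕ} (a : Fin 3), s = List.cons a '' t →
      (t.Finite ∧ t.ncard = k) → s.Finite ∧ s.ncard = k := by
    rintro s t k a rfl ⟨ht, rfl⟩
    exact ⟨ht.image _, Set.ncard_image_of_injective _ (inj a)⟩
  match u, v with
  | [], [] =>
    have : shuffles [] [] = {[]} := by
      ext w
      rcases w with _ | ⟨a, w⟩
      · simp [nil_mem_shuffles]
      · fin_cases a <;> simp [cons_mem_shuffles_zero, cons_mem_shuffles_one, cons_mem_shuffles_two]
    rw [this]
    simp [gapProduct, between_nil]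
  | [], D :: v =>
    rw [gapProduct_two _ _ (between_nil ..)]
    refine step 2 ?_ (shuffles_finite_and_ncard [] v (by simpa using huv))
    ext w
    rcases w with _ | ⟨a, w⟩
    · simp [nil_mem_shuffles]
    · fin_cases a <;> simp [cons_mem_shuffles_zero, cons_mem_shuffles_one, cons_mem_shuffles_two]
  | [], U :: v => simp at huv
  | D :: u, [] => simp at huv
  | U :: u, [] =>
    rw [gapProduct_zero _ _ (between_nil ..)]
    refine step 0 ?_ (shuffles_finite_and_ncard u [] (by simpa using huv))
    ext w
    rcases w with _ | ⟨a, w⟩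
    · simp [nil_mem_shuffles]
    · fin_cases a <;> simp [cons_mem_shuffles_zero, cons_mem_shuffles_one, cons_mem_shuffles_two]
  | D :: u, U :: v =>
    rw [gapProduct_one]
    refine step 1 ?_ (shuffles_finite_and_ncard u v (by simpa using huv))
    ext w
    rcases w with _ | ⟨a, w⟩
    · simp [nil_mem_shuffles]
    · fin_cases a <;> simp [cons_mem_shuffles_zero, cons_mem_shuffles_one, cons_mem_shuffles_two]
  | U :: u, U :: v =>
    rw [gapProduct_zero _ _ (between_cons_self_zero _ _ (by simp) _)]
    refine step 0 ?_ (shuffles_finite_and_ncard u (U :: v) (by simpa using huv))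
    ext w
    rcases w with _ | ⟨a, w⟩
    · simp [nil_mem_shuffles]
    · fin_cases a <;> simp [cons_mem_shuffles_zero, cons_mem_shuffles_one, cons_mem_shuffles_two]
  | D :: u, D :: v =>
    rw [gapProduct_two _ _ (between_cons_self_zero _ _ (by simp) _)]
    refine step 2 ?_ (shuffles_finite_and_ncard (D :: u) v (by simpa using huv))
    ext w
    rcases w with _ | ⟨a, w⟩
    · simp [nil_mem_shuffles]
    · fin_cases a <;> simp [cons_mem_shuffles_zero, cons_mem_shuffles_one, cons_mem_shuffles_two]
  | U :: u, D :: v =>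
    have h₀ := step 0 rfl (shuffles_finite_and_ncard u (D :: v) (by simpa using huv))
    have h₂ := step 2 rfl (shuffles_finite_and_ncard (U :: u) v (by simpa using huv))
    have : shuffles (U :: u) (D :: v) =
        List.cons 0 '' shuffles u (D :: v) ∪ List.cons 2 '' shuffles (U :: u) v := by
      ext w
      rcases w with _ | ⟨a, w⟩
      · simp [nil_mem_shuffles]
      · fin_cases a <;>
          simp [cons_mem_shuffles_zero, cons_mem_shuffles_one, cons_mem_shuffles_two]
    rw [this, Set.ncard_union_eq ?_ h₀.1 h₂.1, h₀.2, h₂.2, gapProduct_zero_two]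
    · exact ⟨h₀.1.union h₂.1, rfl⟩
    · rw [Set.disjoint_left]
      rintro _ ⟨w, -, rfl⟩ ⟨w', -, e⟩
      simp at e
termination_by u.length + v.length

/-- The outer gaps are trivial: no `D` comes before the first `U`, and no `U` after the last `D`. -/
theorem gapProduct_self (p : DyckWord) {n : ℕ} (hp : p.semilength = n) (hn : 1 ≤ n) :
    gapProduct p.toList p.toList =
      ∏ i ∈ Finset.Icc 1 (n - 1), (r p i + s p i).choose (r p i) := by
  obtain ⟨n, rfl⟩ : ∃ m, n = m + 1 := ⟨n - 1, by omega⟩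
  have h₀ : between p.toList U D 0 = 0 := by
    unfold between
    rw [Finset.card_eq_zero, Finset.filter_eq_empty_iff]
    rintro ⟨k, hk⟩ - ⟨h₁, h₂⟩
    have := p.count_D_le_count_U (k + 1)
    rw [List.take_add_one, List.getElem?_eq_getElem hk, List.count_append, List.count_append] at this
    simp only [List.get_eq_getElem] at h₁ h₂
    simp [h₁, h₂] at this
  have h₁ : between p.toList D U (n + 1) = 0 := by
    unfold between
    rw [Finset.card_eq_zero, Finset.filter_eq_empty_iff]
    rintro ⟨k, hk⟩ - ⟨h₁, h₂⟩
    have h₃ := p.count_D_le_count_U k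
    have h₄ : (p.toList.take (k + 1)).count U ≤ p.toList.count U :=
      (List.take_sublist _ _).count_le _
    rw [List.take_add_one, List.getElem?_eq_getElem hk, List.count_append] at h₄
    simp only [List.get_eq_getElem] at h₁ h₂
    simp only [h₁, Option.toList_some, List.count_singleton_self] at h₄
    unfold DyckWord.semilength at hp
    omega
  rw [gapProduct, ← p.semilength_eq_count_D, hp, Finset.prod_range_succ, Finset.prod_range_succ',
    h₀, h₁]
  simp only [add_zero, Nat.choose_self, Nat.choose_zero_right, mul_one, zero_add,
    Nat.add_sub_cancel, r, s]
  rw [← Finset.Ico_add_one_right_eq_Icc, Finset.prod_Ico_eq_prod_range]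
  simp [add_comm]

/-! ### Arrangements of three increasing rows -/

variable {n : ℕ}

/-- The word recording the row of each position. -/
def rowWord (f : Fin 3 × Fin n ≃ Fin (3 * n)) : List (Fin 3) :=
  List.ofFn fun q => (f.symm q).1

theorem count_take_rowWord (f : Fin 3 × Fin n ≃ Fin (3 * n)) (l : Fin 3) (k : ℕ) :
    ((rowWord f).take k).count l =
      (Finset.univ.filter fun i : Fin n => (f (l, i) : ℕ) < k).card := by
  have h₁ : ((rowWord f).take k).count l =
      (Finset.univ.filter fun q : Fin (3 * n) => (q : ℕ) < k ∧ (f.symm q).1 = l).card := by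
    induction k with
    | zero => simp
    | succ k ih =>
      rw [List.take_add_one, List.count_append, ih]
      by_cases hk : k < 3 * n
      · have e : (Finset.univ.filter fun q : Fin (3 * n) => (q : ℕ) < k + 1 ∧ (f.symm q).1 = l) =
            (Finset.univ.filter fun q : Fin (3 * n) => (q : ℕ) < k ∧ (f.symm q).1 = l) ∪
            (if (f.symm ⟨k, hk⟩).1 = l then {⟨k, hk⟩} else ∅) := by
          ext q
          by_cases hq : q = ⟨k, hk⟩
          · subst hq
            split_ifs with h <;> simp [h]
          · have hq' : (q : ℕ) ≠ k := fun h => hq (Fin.ext h)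
            have : (q : ℕ) < k + 1 ↔ (q : ℕ) < k := by omega
            split_ifs with h <;> simp [hq, this, -Order.lt_add_one_iff]
        rw [e, Finset.card_union_of_disjoint]
        · congr 1
          rw [List.getElem?_eq_getElem (by simpa [rowWord] using hk)]
          split_ifs with h <;> simp [rowWord, h]
        · rw [Finset.disjoint_left]
          intro q hq
          simp only [Finset.mem_filter] at hq
          split_ifs with h
          · simp only [Finset.mem_singleton]
            rintro rfl
            simp at hq
          · simp
      · rw [List.getElem?_eq_none (by simp [rowWord]; omega)]
        simp only [Option.toList_none, List.count_nil, add_zero]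
        congr 1
        ext q
        have : (q : ℕ) < k + 1 ↔ (q : ℕ) < k := by omega
        simp [this, -Order.lt_add_one_iff]
  rw [h₁]
  symm
  refine Finset.card_bij (fun i _ => f (l, i)) ?_ ?_ ?_
  · intro i hi
    simpa using hi
  · intro i _ j _ e
    simpa using e
  · intro q hq
    simp only [Finset.mem_filter, Finset.mem_univ, true_and] at hq
    have e : f (l, (f.symm q).2) = q := by rw [← hq.2]; simp
    exact ⟨(f.symm q).2, by simpa [e] using hq.1, e⟩

theorem count_rowWord (f : Fin 3 × Fin n ≃ Fin (3 * n)) (l : Fin 3) :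
    (rowWord f).count l = n := by
  have := count_take_rowWord f l (3 * n)
  rw [List.take_of_length_le (by simp [rowWord])] at this
  simpa using this

/-- As row `l` increases, its entries lying before position `k` form an initial segment of the row.
-/
theorem lt_count_take_rowWord {f : Fin 3 × Fin n ≃ Fin (3 * n)} {l : Fin 3}
    (hf : StrictMono fun i => f (l, i)) (i : Fin n) (k : ℕ) :
    (i : ℕ) < ((rowWord f).take k).count l ↔ (f (l, i) : ℕ) < k := by
  rw [count_take_rowWord]
  constructor
  · contrapose!
    intro hk
    calc _ ≤ (Finset.Iio i).card := Finset.card_le_card fun j hj => by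
            simp only [Finset.mem_filter, Finset.mem_univ, true_and] at hj
            rw [Finset.mem_Iio, ← hf.lt_iff_lt, Fin.lt_def]
            exact hj.trans_le hk
      _ = i := by simp
  · intro hk
    calc (i : ℕ) < (Finset.Iic i).card := by simp
      _ ≤ _ := Finset.card_le_card fun j hj => by
            rw [Finset.mem_Iic, ← hf.le_iff_le, Fin.le_def] at hj
            simpa using hj.trans_lt hk

theorem precedes_rowWord {f : Fin 3 × Fin n ≃ Fin (3 * n)}
    (hf : ∀ l, StrictMono fun i => f (l, i)) (l l' : Fin 3) (i j : Fin n) :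
    Precedes (rowWord f) l i l' j ↔ f (l, i) < f (l', j) := by
  constructor
  · rintro ⟨p, hp, h₁, h₂⟩
    rw [List.prefix_iff_eq_take.1 hp] at h₁ h₂
    rw [lt_count_take_rowWord (hf l)] at h₁
    rw [← not_lt, lt_count_take_rowWord (hf l')] at h₂
    exact Fin.lt_def.2 (by omega)
  · intro h
    refine ⟨(rowWord f).take (f (l', j)), List.take_prefix _ _, ?_, ?_⟩
    · exact (lt_count_take_rowWord (hf l) _ _).2 h
    · rw [← not_lt, lt_count_take_rowWord (hf l')]
      simp

theorem eq_of_rowWord_eq {f g : Fin 3 × Fin n ≃ Fin (3 * n)}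
    (hf : ∀ l, StrictMono fun i => f (l, i)) (hg : ∀ l, StrictMono fun i => g (l, i))
    (h : rowWord f = rowWord g) : f = g := by
  ext ⟨l, i⟩
  have key : ∀ k, (f (l, i) : ℕ) < k ↔ (g (l, i) : ℕ) < k := fun k => by
    rw [← lt_count_take_rowWord (hf l), ← lt_count_take_rowWord (hg l), h]
  have h₁ := key (f (l, i))
  have h₂ := key (g (l, i))
  omega

theorem exists_rowWord_eq (w : List (Fin 3)) (hw : ∀ l, w.count l = n) :
    ∃ f : Fin 3 × Fin n ≃ Fin (3 * n), (∀ l, StrictMono fun i => f (l, i)) ∧ rowWord f = w := by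
  have hlen : w.length = 3 * n := by
    have : w.length = w.count 0 + w.count 1 + w.count 2 := by
      clear hw
      induction w with
      | nil => rfl
      | cons a w ih => fin_cases a <;> simp <;> omega
    rw [this, hw, hw, hw]
    ring
  obtain ⟨L, rfl⟩ : ∃ L : Fin (3 * n) → Fin 3, w = List.ofFn L := by
    exact ⟨fun q => w.get (q.cast hlen.symm), by
      apply List.ext_get
      · simp [hlen]
      · simp⟩
  have hcard : ∀ l, (Finset.univ.filter fun q => L q = l).card = n := by
    intro l
    refine Eq.trans ?_ (hw l)
    rw [← Multiset.coe_count, ← Fin.univ_val_map, Multiset.count_map]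
    simp only [eq_comm (a := l)]
    rfl
  -- Row `l` lists the positions of the letter `l` in increasing order.
  let g : Fin 3 × Fin n → Fin (3 * n) := fun x => Finset.orderEmbOfFin _ (hcard x.1) x.2
  have hL : ∀ x, L (g x) = x.1 := fun x => by
    exact (Finset.mem_filter.1 (Finset.orderEmbOfFin_mem _ (hcard x.1) x.2)).2
  have hg : Function.Bijective g := by
    rw [Fintype.bijective_iff_injective_and_card]
    refine ⟨?_, by simp⟩
    rintro ⟨l, i⟩ ⟨l', j⟩ e
    obtain rfl : l = l' := by simpa [hL] using congrArg L e
    simpa [g] using e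
  refine ⟨Equiv.ofBijective g hg, fun l => ?_, ?_⟩
  · exact (Finset.orderEmbOfFin _ (hcard l)).strictMono
  · unfold rowWord
    congr 1
    ext1 q
    rw [← hL, ← Equiv.ofBijective_apply g hg, Equiv.apply_symm_apply]

/-! ### Two-letter projections and the Dyck word of an arrangement -/

theorem count_lowerStep (w : List (Fin 3)) :
    (w.filterMap lowerStep).count U = w.count 0 ∧ (w.filterMap lowerStep).count D = w.count 1 := by
  induction w with
  | nil => simp
  | cons a w ih => fin_cases a <;> simp [List.filterMap_cons, lowerStep] <;> exact ih

theorem count_upperStep (w : List (Fin 3)) :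
    (w.filterMap upperStep).count U = w.count 1 ∧ (w.filterMap upperStep).count D = w.count 2 := by
  induction w with
  | nil => simp
  | cons a w ih => fin_cases a <;> simp [List.filterMap_cons, upperStep] <;> exact ih

/-- Every prefix of the projected word is the projection of a prefix of `w`. -/
theorem precedes_lowerStep (w : List (Fin 3)) (i j : ℕ) :
    Precedes (w.filterMap lowerStep) D i U j ↔ Precedes w 1 i 0 j := by
  constructor
  · rintro ⟨p, hp, h₁, h₂⟩
    obtain ⟨q, hq, rfl⟩ := List.prefix_filterMap_iff.1 hp
    rw [(count_lowerStep q).1] at h₂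
    rw [(count_lowerStep q).2] at h₁
    exact ⟨q, hq, h₁, h₂⟩
  · rintro ⟨p, hp, h₁, h₂⟩
    exact ⟨_, hp.filterMap _, by rwa [(count_lowerStep p).2], by rwa [(count_lowerStep p).1]⟩

theorem precedes_upperStep (w : List (Fin 3)) (i j : ℕ) :
    Precedes (w.filterMap upperStep) D i U j ↔ Precedes w 2 i 1 j := by
  constructor
  · rintro ⟨p, hp, h₁, h₂⟩
    obtain ⟨q, hq, rfl⟩ := List.prefix_filterMap_iff.1 hp
    rw [(count_upperStep q).1] at h₂
    rw [(count_upperStep q).2] at h₁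
    exact ⟨q, hq, h₁, h₂⟩
  · rintro ⟨p, hp, h₁, h₂⟩
    exact ⟨_, hp.filterMap _, by rwa [(count_upperStep p).2], by rwa [(count_upperStep p).1]⟩

/-- An arrangement of `3n` points in three increasing rows with increasing columns, such that the
first and second row are interleaved in the same way as the second and third row. -/
structure IsArrangement (f : Fin 3 × Fin n ≃ Fin (3 * n)) : Prop where
  strictMono : ∀ l, StrictMono fun i => f (l, i)
  lower_lt : ∀ i, f (0, i) < f (1, i)
  upper_lt : ∀ i, f (1, i) < f (2, i)
  lt_iff : ∀ i j, f (1, i) < f (0, j) ↔ f (2, i) < f (1, j)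

theorem IsArrangement.lowerStep_eq_upperStep {f : Fin 3 × Fin n ≃ Fin (3 * n)}
    (hf : IsArrangement f) :
    (rowWord f).filterMap lowerStep = (rowWord f).filterMap upperStep := by
  apply eq_of_precedes_iff
  · rw [(count_lowerStep _).1, (count_upperStep _).1, count_rowWord, count_rowWord]
  · rw [(count_lowerStep _).2, (count_upperStep _).2, count_rowWord, count_rowWord]
  · rw [(count_lowerStep _).1, (count_lowerStep _).2, count_rowWord, count_rowWord]
    intro i hi j hj
    rw [precedes_lowerStep, precedes_upperStep,
      precedes_rowWord hf.strictMono 1 0 ⟨i, hi⟩ ⟨j, hj⟩,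
      precedes_rowWord hf.strictMono 2 1 ⟨i, hi⟩ ⟨j, hj⟩, hf.lt_iff]

/-- The Dyck word describing how consecutive rows of an arrangement are interleaved. -/
def IsArrangement.dyckWord {f : Fin 3 × Fin n ≃ Fin (3 * n)} (hf : IsArrangement f) :
    DyckWord where
  toList := (rowWord f).filterMap lowerStep
  count_U_eq_count_D := by
    rw [(count_lowerStep _).1, (count_lowerStep _).2, count_rowWord, count_rowWord]
  count_D_le_count_U k := by
    by_contra! hlt
    set p := ((rowWord f).filterMap lowerStep).take k with hp
    have hpre : Precedes ((rowWord f).filterMap lowerStep) D (p.count U) U (p.count U) :=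
      ⟨p, List.take_prefix _ _, hlt, le_rfl⟩
    have hn : p.count D ≤ n := by
      calc p.count D ≤ ((rowWord f).filterMap lowerStep).count D :=
            (List.take_sublist _ _).count_le _
        _ = n := by rw [(count_lowerStep _).2, count_rowWord]
    rw [precedes_lowerStep,
      precedes_rowWord hf.strictMono 1 0 ⟨p.count U, by omega⟩ ⟨p.count U, by omega⟩] at hpre
    exact lt_asymm hpre (hf.lower_lt _)

theorem IsArrangement.semilength_dyckWord {f : Fin 3 × Fin n ≃ Fin (3 * n)}
    (hf : IsArrangement f) : hf.dyckWord.semilength = n := by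
  rw [DyckWord.semilength, IsArrangement.dyckWord, (count_lowerStep _).1, count_rowWord]

theorem IsArrangement.precedes_dyckWord {f : Fin 3 × Fin n ≃ Fin (3 * n)}
    (hf : IsArrangement f) (i j : Fin n) :
    Precedes hf.dyckWord.toList D i U j ↔ f (2, i) < f (1, j) := by
  rw [IsArrangement.dyckWord, precedes_lowerStep, precedes_rowWord hf.strictMono, hf.lt_iff]

theorem isArrangement_of_rowWord_mem {f : Fin 3 × Fin n ≃ Fin (3 * n)} {p : DyckWord}
    (hf : ∀ l, StrictMono fun i => f (l, i)) (hw : rowWord f ∈ shuffles p.toList p.toList) :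
    IsArrangement f := by
  have h₁ : ∀ i j : Fin n, Precedes p.toList D i U j ↔ f (1, i) < f (0, j) := fun i j => by
    rw [← hw.1, precedes_lowerStep, precedes_rowWord hf]
  have h₂ : ∀ i j : Fin n, Precedes p.toList D i U j ↔ f (2, i) < f (1, j) := fun i j => by
    rw [← hw.2, precedes_upperStep, precedes_rowWord hf]
  refine ⟨hf, fun i => ?_, fun i => ?_, fun i j => by rw [← h₁, ← h₂]⟩
  · have := not_precedes_self p i
    rw [h₁, not_lt] at this
    exact this.lt_of_ne fun e => by simpa using f.injective e
  · have := not_precedes_self p i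
    rw [h₂, not_lt] at this
    exact this.lt_of_ne fun e => by simpa using f.injective e

/-- The arrangements interleaved according to a given Dyck word are counted by shuffles. -/
theorem card_arrangements (p : DyckWord) (hp : p.semilength = n) :
    Nat.card {f : {f : Fin 3 × Fin n ≃ Fin (3 * n) // IsArrangement f} // f.2.dyckWord = p} =
      (shuffles p.toList p.toList).ncard := by
  rw [← Nat.card_coe_set_eq]
  refine Nat.card_eq_of_bijective (fun f => ⟨rowWord f.1.1, ?_, ?_⟩) ⟨?_, ?_⟩
  · exact congrArg DyckWord.toList f.2
  · exact f.1.2.lowerStep_eq_upperStep.symm.trans (congrArg DyckWord.toList f.2)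
  · rintro ⟨⟨f, hf⟩, hfp⟩ ⟨⟨g, hg⟩, hgp⟩ e
    simp only [Subtype.mk.injEq]
    exact eq_of_rowWord_eq hf.strictMono hg.strictMono (congrArg Subtype.val e)
  · rintro ⟨w, hw⟩
    have hcount : ∀ l, w.count l = n := by
      intro l
      fin_cases l
      · exact (count_lowerStep w).1.symm.trans (by rw [hw.1]; exact hp)
      · exact (count_lowerStep w).2.symm.trans (by rw [hw.1, ← p.semilength_eq_count_D]; exact hp)
      · exact (count_upperStep w).2.symm.trans (by rw [hw.2, ← p.semilength_eq_count_D]; exact hp)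
    obtain ⟨f, hf, rfl⟩ := exists_rowWord_eq w hcount
    exact ⟨⟨⟨f, isArrangement_of_rowWord_mem hf hw⟩, DyckWord.ext hw.1⟩, rfl⟩

/-! ### Permutations composed of three-cycles avoiding `321` -/

theorem avoids_pattern321_iff {m : ℕ} (π : Equiv.Perm (Fin m)) :
    Avoids π pattern321 ↔ ∀ a b c, a < b → b < c → π b < π a → ¬ π c < π b := by
  unfold Avoids
  constructor
  · intro H a b c hab hbc hba hcb
    refine H ⟨OrderEmbedding.ofStrictMono ![a, b, c] ?_, ?_⟩
    · intro i j hij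
      fin_cases i <;> fin_cases j <;> simp_all [hab.trans hbc]
    · intro i j
      have hca := hcb.trans hba
      change π (![a, b, c] i) < π (![a, b, c] j) ↔ i.rev < j.rev
      fin_cases i <;> fin_cases j <;> simp [hba, hcb, hca, hba.le, hcb.le, hca.le]
  · rintro H ⟨f, hf⟩
    refine H (f 0) (f 1) (f 2) (f.strictMono (by decide)) (f.strictMono (by decide)) ?_ ?_
    · exact (hf _ _).2 (by decide)
    · exact (hf _ _).2 (by decide)

/-- A fixed-point-free permutation avoids `321` iff it is increasing on its excedances and on its
deficiencies. -/
theorem avoids_iff_monotone {m : ℕ} (π : Equiv.Perm (Fin m)) (hπ : ∀ x, π x ≠ x) :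
    Avoids π pattern321 ↔ (∀ x y, x < π x → y < π y → x < y → π x < π y) ∧
      ∀ x y, π x < x → π y < y → x < y → π x < π y := by
  rw [avoids_pattern321_iff]
  constructor
  · intro H
    refine ⟨fun x y hx hy hxy => ?_, fun x y hx hy hxy => ?_⟩
    · by_contra hlt
      have hyx : π y < π x := (not_lt.1 hlt).lt_of_ne fun e => hxy.ne' (π.injective e)
      -- Each `z > y` has `π z > π y`, else `x, y, z` carry a `321`. So `π` injects `Ioi y` into
      -- `Ioi (π y)`, which is smaller because `y < π y`. The deficiency case below is the mirror
      -- image.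
      have : (Finset.Ioi y).card ≤ (Finset.Ioi (π y)).card :=
        Finset.card_le_card_of_injOn π (fun z hz => by
          have hz : y < z := by simpa using hz
          have := H x y z hxy hz hyx
          simpa using (not_lt.1 this).lt_of_ne fun e => hz.ne (π.injective e)) π.injective.injOn
      simp only [Fin.card_Ioi] at this
      have h₁ := (π y).isLt
      have h₂ : (y : ℕ) < π y := hy
      omega
    · by_contra hlt
      have hyx : π y < π x := (not_lt.1 hlt).lt_of_ne fun e => hxy.ne' (π.injective e)
      have : (Finset.Iio x).card ≤ (Finset.Iio (π x)).card :=
        Finset.card_le_card_of_injOn π (fun z hz => by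
          have hz : z < x := by simpa using hz
          have := fun h => H z x y hz hxy h hyx
          simpa using (not_lt.1 this).lt_of_ne fun e => hz.ne (π.injective e)) π.injective.injOn
      simp only [Fin.card_Iio] at this
      have h₂ : (π x : ℕ) < x := hx
      omega
  · rintro ⟨h₁, h₂⟩ a b c hab hbc hba hcb
    -- In a `321`, if the middle entry is a deficiency then so is the last one; if it is an
    -- excedance then so is the first.
    rcases lt_or_gt_of_ne (hπ b) with hb | hb
    · have hc : π c < c := (hcb.trans hb).trans hbc
      exact lt_asymm hcb (h₂ b c hb hc hbc)
    · have ha : a < π a := (hab.trans hb).trans hba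
      exact lt_asymm hba (h₁ a b ha hb hab)

theorem cycleType_eq_replicate_three_iff (π : Equiv.Perm (Fin (3 * n))) :
    π.cycleType = Multiset.replicate n 3 ↔ (∀ x, π (π (π x)) = x) ∧ ∀ x, π x ≠ x := by
  have : Fact (Nat.Prime 3) := ⟨Nat.prime_three⟩
  have hpow : π ^ 3 = 1 ↔ ∀ x, π (π (π x)) = x := by
    rw [Equiv.Perm.ext_iff]; rfl
  have hsupp : π.support.card = 3 * n ↔ ∀ x, π x ≠ x := by
    have : π.support.card = 3 * n ↔ π.support.card = Fintype.card (Fin (3 * n)) := by simp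
    rw [this, Finset.card_eq_iff_eq_univ, Finset.eq_univ_iff_forall]
    simp
  rw [← hpow, ← hsupp, ← Equiv.Perm.sum_cycleType, Equiv.Perm.pow_prime_eq_one_iff]
  constructor
  · intro h
    rw [h]
    exact ⟨fun c hc => Multiset.eq_of_mem_replicate hc, by simp [mul_comm]⟩
  · rintro ⟨h₁, h₂⟩
    have h₃ := Multiset.eq_replicate_card.2 h₁
    rw [h₃] at h₂ ⊢
    congr 1
    simp at h₂
    omega

theorem mem_avStar_pattern321 (π : Equiv.Perm (Fin (3 * n))) :
    π ∈ avStar n pattern321 ↔ (∀ x, π (π (π x)) = x) ∧ (∀ x, π x ≠ x) ∧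
      (∀ x y, x < π x → y < π y → x < y → π x < π y) ∧
      ∀ x y, π x < x → π y < y → x < y → π x < π y := by
  have : π ∈ avStar n pattern321 ↔
    π.cycleType = Multiset.replicate n 3 ∧ Avoids π pattern321 := Iff.rfl
  rw [this, cycleType_eq_replicate_three_iff, and_assoc]
  refine and_congr_right fun _ => and_congr_right fun h => ?_
  rw [avoids_iff_monotone π h]

/-! ### Oriented arrangements as permutations -/

/-- Rotate the `i`-th column of a `3 × n` array upwards if `t i` and downwards otherwise. -/
def rotateColumns (t : Fin n → Bool) : Equiv.Perm (Fin 3 × Fin n) where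
  toFun x := (bif t x.2 then x.1 + 1 else x.1 - 1, x.2)
  invFun x := (bif t x.2 then x.1 - 1 else x.1 + 1, x.2)
  left_inv := by
    rintro ⟨l, i⟩
    cases h : t i <;> simp [h]
  right_inv := by
    rintro ⟨l, i⟩
    cases h : t i <;> simp [h]

/-- The permutation whose cycles are the columns of `f`, oriented by `t`. -/
def columnPerm (f : Fin 3 × Fin n ≃ Fin (3 * n)) (t : Fin n → Bool) :
    Equiv.Perm (Fin (3 * n)) :=
  f.permCongr (rotateColumns t)

theorem columnPerm_apply (f : Fin 3 × Fin n ≃ Fin (3 * n)) (t : Fin n → Bool) (l : Fin 3)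
    (i : Fin n) : columnPerm f t (f (l, i)) = f (bif t i then l + 1 else l - 1, i) := by
  simp [columnPerm, Equiv.permCongr_apply, rotateColumns]

theorem columnPerm_true {f : Fin 3 × Fin n ≃ Fin (3 * n)} {t : Fin n → Bool} {i : Fin n}
    (h : t i = true) : columnPerm f t (f (0, i)) = f (1, i) ∧
      columnPerm f t (f (1, i)) = f (2, i) ∧ columnPerm f t (f (2, i)) = f (0, i) := by
  simp only [columnPerm_apply, h]
  exact ⟨rfl, rfl, rfl⟩

theorem columnPerm_false {f : Fin 3 × Fin n ≃ Fin (3 * n)} {t : Fin n → Bool} {i : Fin n}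
    (h : t i = false) : columnPerm f t (f (0, i)) = f (2, i) ∧
      columnPerm f t (f (2, i)) = f (1, i) ∧ columnPerm f t (f (1, i)) = f (0, i) := by
  simp only [columnPerm_apply, h]
  exact ⟨rfl, rfl, rfl⟩

/-- An orientation of the columns of an arrangement that changes only between columns that are
not interleaved. -/
def IsOrientation (f : Fin 3 × Fin n ≃ Fin (3 * n)) (t : Fin n → Bool) : Prop :=
  ∀ i j, i < j → t i ≠ t j → f (2, i) < f (1, j)

theorem forall_fin_three_prod {P : Fin (3 * n) → Prop} (f : Fin 3 × Fin n ≃ Fin (3 * n)) :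
    (∀ x, P x) ↔ ∀ i, P (f (0, i)) ∧ P (f (1, i)) ∧ P (f (2, i)) := by
  rw [f.symm.forall_congr_left]
  simp only [Equiv.symm_symm, Prod.forall, Fin.forall_fin_succ]
  simp [forall_and]

/-- Only two columns need comparing at a time. Equal orientations reduce to increasing rows and
`lt_iff`; opposite ones give `f (2, i) < f (1, j)`, hence also `f (1, i) < f (0, j)`, for `i < j`.
-/
theorem columnPerm_mem_avStar {f : Fin 3 × Fin n ≃ Fin (3 * n)} {t : Fin n → Bool}
    (hf : IsArrangement f) (ht : IsOrientation f t) : columnPerm f t ∈ avStar n pattern321 := by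
  rw [mem_avStar_pattern321]
  have lo := hf.lower_lt
  have up := hf.upper_lt
  refine ⟨?_, ?_, ?_⟩
  · rw [forall_fin_three_prod f]
    intro i
    cases h : t i
    · obtain ⟨h₁, h₂, h₃⟩ := columnPerm_false (f := f) h
      simp only [h₁, h₂, h₃, and_self]
    · obtain ⟨h₁, h₂, h₃⟩ := columnPerm_true (f := f) h
      simp only [h₁, h₂, h₃, and_self]
  · rw [forall_fin_three_prod f]
    intro i
    have h01 := lo i
    have h12 := up i
    cases h : t i
    · obtain ⟨h₁, h₂, h₃⟩ := columnPerm_false (f := f) h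
      rw [h₁, h₂, h₃]
      exact ⟨(h01.trans h12).ne', h01.ne, h12.ne⟩
    · obtain ⟨h₁, h₂, h₃⟩ := columnPerm_true (f := f) h
      rw [h₁, h₂, h₃]
      exact ⟨h01.ne', h12.ne', (h01.trans h12).ne⟩
  · have key : ∀ i j : Fin n,
        (i = j ∨
        ((f (0, i) < f (0, j) ∧ f (1, i) < f (1, j) ∧ f (2, i) < f (2, j)) ∧
          (f (1, i) < f (0, j) ↔ f (2, i) < f (1, j)) ∧ (t i ≠ t j → f (2, i) < f (1, j))) ∨
        ((f (0, j) < f (0, i) ∧ f (1, j) < f (1, i) ∧ f (2, j) < f (2, i)) ∧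
          (f (1, j) < f (0, i) ↔ f (2, j) < f (1, i)) ∧ (t j ≠ t i → f (2, j) < f (1, i)))) := by
      intro i j
      rcases lt_trichotomy i j with h | h | h
      · exact .inr (.inl ⟨⟨hf.strictMono 0 h, hf.strictMono 1 h, hf.strictMono 2 h⟩,
          hf.lt_iff i j, ht i j h⟩)
      · exact .inl h
      · exact .inr (.inr ⟨⟨hf.strictMono 0 h, hf.strictMono 1 h, hf.strictMono 2 h⟩,
          hf.lt_iff j i, ht j i h⟩)
    have cols : ∀ i, (t i = true ∧ columnPerm f t (f (0, i)) = f (1, i) ∧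
        columnPerm f t (f (1, i)) = f (2, i) ∧ columnPerm f t (f (2, i)) = f (0, i)) ∨
        (t i = false ∧ columnPerm f t (f (0, i)) = f (2, i) ∧
        columnPerm f t (f (2, i)) = f (1, i) ∧ columnPerm f t (f (1, i)) = f (0, i)) := by
      intro i
      cases h : t i
      · exact .inr ⟨rfl, columnPerm_false h⟩
      · exact .inl ⟨rfl, columnPerm_true h⟩
    constructor
    all_goals
      simp only [forall_fin_three_prod f]
      intro i
      refine ⟨fun j => ?_, fun j => ?_, fun j => ?_⟩
      all_goals
        have hij := key i j
        have hi := lo i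
        have hi' := up i
        have hj := lo j
        have hj' := up j
        -- Negating a strict inequality leaves a possible equality, which injectivity of `f`
        -- excludes.
        have hne : (f (1, i) : ℕ) ≠ f (2, j) := fun e => by simpa using f.injective (Fin.ext e)
        have hne' : (f (0, i) : ℕ) ≠ f (1, j) := fun e => by simpa using f.injective (Fin.ext e)
        rcases cols i with ⟨ti, i₀, i₁, i₂⟩ | ⟨ti, i₀, i₁, i₂⟩ <;>
        rcases cols j with ⟨tj, j₀, j₁, j₂⟩ | ⟨tj, j₀, j₁, j₂⟩ <;>
        rcases hij with rfl | ⟨⟨h₀, h₁, h₂⟩, h₃, h₄⟩ | ⟨⟨h₀, h₁, h₂⟩, h₃, h₄⟩ <;>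
        simp only [i₀, i₁, i₂, j₀, j₁, j₂] <;>
        try replace h₄ := h₄ (by rw [ti, tj]; decide)
        all_goals
          first
          | exact absurd (ti.symm.trans tj) (by decide)
          | (simp only [Fin.lt_def] at *
             refine ⟨?_, ?_, ?_⟩ <;> intros <;> omega)

/-- Row 0 consists of the cycle minima, so the permutation alone determines it. -/
theorem mem_range_row_zero_iff {f : Fin 3 × Fin n ≃ Fin (3 * n)} {t : Fin n → Bool}
    (hf : IsArrangement f) (x : Fin (3 * n)) :
    x ∈ Set.range (fun i => f (0, i)) ↔
      x < columnPerm f t x ∧ x < columnPerm f t (columnPerm f t x) := by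
  have lo := hf.lower_lt
  have up := hf.upper_lt
  revert x
  rw [forall_fin_three_prod f]
  intro i
  have h01 := lo i
  have h12 := up i
  cases h : t i
  · obtain ⟨h₁, h₂, h₃⟩ := columnPerm_false (f := f) h
    simp [h₁, h₂, h₃, h01, h12, h01.trans h12, h01.le, h12.le]
  · obtain ⟨h₁, h₂, h₃⟩ := columnPerm_true (f := f) h
    simp [h₁, h₂, h₃, h01, h12, h01.trans h12, h01.le, h12.le]

/-- An increasing row is determined by its range, so the top-level data in row 0 agree. The other
two entries of a column are the first and second iterates of its minimum, and their order reveals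
the orientation. -/
theorem columnPerm_injective {f g : Fin 3 × Fin n ≃ Fin (3 * n)} {t u : Fin n → Bool}
    (hf : IsArrangement f) (hg : IsArrangement g) (h : columnPerm f t = columnPerm g u) :
    f = g ∧ t = u := by
  have h₀ : (fun i => f (0, i)) = fun i => g (0, i) := by
    rw [← StrictMono.range_inj (hf.strictMono 0) (hg.strictMono 0)]
    ext x
    rw [mem_range_row_zero_iff hf (t := t), mem_range_row_zero_iff hg (t := u), h]
  have key : ∀ i, (f (1, i) = g (1, i) ∧ f (2, i) = g (2, i)) ∧ t i = u i := by
    intro i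
    have e : f (0, i) = g (0, i) := congrFun h₀ i
    have hf' := hf.upper_lt i
    have hg' := hg.upper_lt i
    cases ht : t i <;> cases hu : u i
    · obtain ⟨h₁, h₂, h₃⟩ := columnPerm_false (f := f) ht
      obtain ⟨h₁', h₂', h₃'⟩ := columnPerm_false (f := g) hu
      grind
    · obtain ⟨h₁, h₂, h₃⟩ := columnPerm_false (f := f) ht
      obtain ⟨h₁', h₂', h₃'⟩ := columnPerm_true (f := g) hu
      grind
    · obtain ⟨h₁, h₂, h₃⟩ := columnPerm_true (f := f) ht
      obtain ⟨h₁', h₂', h₃'⟩ := columnPerm_false (f := g) hu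
      grind
    · obtain ⟨h₁, h₂, h₃⟩ := columnPerm_true (f := f) ht
      obtain ⟨h₁', h₂', h₃'⟩ := columnPerm_true (f := g) hu
      grind
  refine ⟨?_, funext fun i => (key i).2⟩
  ext ⟨l, i⟩
  fin_cases l
  · exact congrArg Fin.val (congrFun h₀ i)
  · exact congrArg Fin.val (key i).1.1
  · exact congrArg Fin.val (key i).1.2

theorem exists_columnPerm_eq {π : Equiv.Perm (Fin (3 * n))} (h₃ : ∀ x, π (π (π x)) = x)
    (hfix : ∀ x, π x ≠ x) :
    ∃ (f : Fin 3 × Fin n ≃ Fin (3 * n)) (t : Fin n → Bool), columnPerm f t = π ∧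
      (StrictMono fun i => f (0, i)) ∧ ∀ i, f (0, i) < f (1, i) ∧ f (1, i) < f (2, i) := by
  have hfix₂ : ∀ x, π (π x) ≠ x := fun x e => hfix x (by rw [← e, h₃, e])
  let M : Finset (Fin (3 * n)) := Finset.univ.filter fun x => x < π x ∧ x < π (π x)
  have hM : ∀ x : M, (x : Fin (3 * n)) < π x ∧ (x : Fin (3 * n)) < π (π x) := fun x =>
    (Finset.mem_filter.1 x.2).2
  let g : Fin 3 × M → Fin (3 * n) := fun x =>
    ![(x.2 : Fin (3 * n)), min (π x.2) (π (π x.2)), max (π x.2) (π (π x.2))] x.1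
  have g₀ : ∀ x, g (0, x) = x := fun _ => rfl
  have g₁ : ∀ x, g (1, x) = min (π x) (π (π x)) := fun _ => rfl
  have g₂ : ∀ x, g (2, x) = max (π x) (π (π x)) := fun _ => rfl
  have hg : Function.Bijective g := by
    constructor
    -- The minimum over the orbit of an entry recovers its column.
    · have hmin : ∀ x, min (g x) (min (π (g x)) (π (π (g x)))) = x.2 := by
        rintro ⟨l, x⟩
        have hx := hM x
        have aux : ∀ z, z = (x : Fin (3 * n)) ∨ z = π x ∨ z = π (π x) →
            min z (min (π z) (π (π z))) = x := by
          rintro z (rfl | rfl | rfl)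
          · exact min_eq_left (le_min hx.1.le hx.2.le)
          · rw [h₃, min_eq_right hx.2.le, min_eq_right hx.1.le]
          · rw [h₃, min_eq_left hx.1.le, min_eq_right hx.2.le]
        apply aux
        fin_cases l
        · exact .inl rfl
        · exact .inr (min_choice _ _)
        · exact .inr (max_choice _ _)
      rintro ⟨l, x⟩ ⟨k, y⟩ e
      obtain rfl : x = y := by
        have h₁ := hmin (l, x)
        rw [e, hmin (k, y)] at h₁
        exact (Subtype.ext h₁).symm
      have h01 : g (0, x) < g (1, x) := lt_min (hM x).1 (hM x).2
      have h12 : g (1, x) < g (2, x) := min_lt_max.2 (hfix _).symm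
      have hmono : StrictMono fun l => g (l, x) := by
        rw [Fin.strictMono_iff_lt_succ]
        intro l
        fin_cases l
        · exact h01
        · exact h12
      rw [hmono.injective e]
    · have aux : ∀ (x : M) z, z = π x ∨ z = π (π x) → ∃ y, g y = z := by
        rintro x z hz
        rcases le_total (π x) (π (π x)) with h | h <;> rcases hz with rfl | rfl
        · exact ⟨(1, x), min_eq_left h⟩
        · exact ⟨(2, x), max_eq_right h⟩
        · exact ⟨(2, x), max_eq_left h⟩
        · exact ⟨(1, x), min_eq_right h⟩
      intro z
      have h₁ := hfix z
      have h₂ := hfix₂ z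
      have h₂' := hfix (π z)
      by_cases hz : z < π z ∧ z < π (π z)
      · exact ⟨(0, ⟨z, Finset.mem_filter.2 ⟨Finset.mem_univ _, hz⟩⟩), rfl⟩
      · rcases lt_or_gt_of_ne h₂' with h | h
        · refine aux ⟨π (π z), Finset.mem_filter.2 ⟨Finset.mem_univ _, ?_⟩⟩ z (.inl (h₃ z).symm)
          rw [h₃]
          grind
        · refine aux ⟨π z, Finset.mem_filter.2 ⟨Finset.mem_univ _, ?_⟩⟩ z (.inr (h₃ z).symm)
          rw [h₃]
          grind
  have hcard : M.card = n := by
    have := Fintype.card_congr (Equiv.ofBijective g hg)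
    simp only [Fintype.card_prod, Fintype.card_fin, Fintype.card_coe] at this
    omega
  let e := M.orderIsoOfFin hcard
  let f : Fin 3 × Fin n ≃ Fin (3 * n) :=
    ((Equiv.refl _).prodCongr e.toEquiv).trans (Equiv.ofBijective g hg)
  have f₀ : ∀ i, f (0, i) = e i := fun i => g₀ _
  have f₁ : ∀ i, f (1, i) = min (π (e i)) (π (π (e i))) := fun i => g₁ _
  have f₂ : ∀ i, f (2, i) = max (π (e i)) (π (π (e i))) := fun i => g₂ _
  refine ⟨f, fun i => decide (π (e i) < π (π (e i))), ?_, ?_, ?_⟩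
  · rw [Equiv.ext_iff, forall_fin_three_prod f]
    intro i
    by_cases h : π (e i) < π (π (e i))
    · obtain ⟨c₀, c₁, c₂⟩ := columnPerm_true (f := f)
        (t := fun i => decide (π (e i) < π (π (e i)))) (i := i) (by simpa using h)
      rw [c₀, c₁, c₂, f₀, f₁, f₂, min_eq_left h.le, max_eq_right h.le, h₃]
      exact ⟨rfl, rfl, rfl⟩
    · obtain ⟨c₀, c₁, c₂⟩ := columnPerm_false (f := f)
        (t := fun i => decide (π (e i) < π (π (e i)))) (i := i) (by simpa using h)
      rw [c₀, c₁, c₂, f₀, f₁, f₂, min_eq_right (not_lt.1 h), max_eq_left (not_lt.1 h), h₃]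
      exact ⟨rfl, rfl, rfl⟩
  · intro i j hij
    simp only [f₀]
    exact e.strictMono hij
  · intro i
    rw [f₀, f₁, f₂]
    exact ⟨lt_min (hM _).1 (hM _).2, min_lt_max.2 (hfix _).symm⟩

/-- For columns `i < j`, each pair of orientations needs only a few instances of monotonicity,
applied to entries that are both excedances or both deficiencies. -/
theorem exists_arrangement {π : Equiv.Perm (Fin (3 * n))} (hπ : π ∈ avStar n pattern321) :
    ∃ (f : Fin 3 × Fin n ≃ Fin (3 * n)) (t : Fin n → Bool), IsArrangement f ∧
      IsOrientation f t ∧ columnPerm f t = π := by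
  rw [mem_avStar_pattern321] at hπ
  obtain ⟨h₃, hfix, hexc, hdef⟩ := hπ
  obtain ⟨f, t, rfl, hmono, hlt⟩ := exists_columnPerm_eq h₃ hfix
  have key : ∀ i j, i < j → f (1, i) < f (1, j) ∧ f (2, i) < f (2, j) ∧
      (f (1, i) < f (0, j) ↔ f (2, i) < f (1, j)) ∧ (t i ≠ t j → f (2, i) < f (1, j)) := by
    intro i j hij
    have ha := hmono hij
    have hi := hlt i
    have hj := hlt j
    have ne₁ : f (1, i) ≠ f (1, j) := fun e => hij.ne (by simpa using f.injective e)
    have ne₂ : f (1, i) ≠ f (0, j) := fun e => by simpa using f.injective e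
    have ne₃ : f (2, i) ≠ f (1, j) := fun e => by simpa using f.injective e
    cases ti : t i <;> cases tj : t j
    · obtain ⟨i₀, i₁, i₂⟩ := columnPerm_false (f := f) ti
      obtain ⟨j₀, j₁, j₂⟩ := columnPerm_false (f := f) tj
      have e₁ := hexc (f (0, i)) (f (0, j))
      have e₂ := hdef (f (1, j)) (f (1, i))
      have e₃ := hdef (f (2, i)) (f (1, j))
      have e₄ := hdef (f (1, j)) (f (2, i))
      grind
    · obtain ⟨i₀, i₁, i₂⟩ := columnPerm_false (f := f) ti
      obtain ⟨j₀, j₁, j₂⟩ := columnPerm_true (f := f) tj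
      have e₁ := hexc (f (0, i)) (f (0, j))
      have e₂ := hdef (f (2, i)) (f (2, j))
      grind
    · obtain ⟨i₀, i₁, i₂⟩ := columnPerm_true (f := f) ti
      obtain ⟨j₀, j₁, j₂⟩ := columnPerm_false (f := f) tj
      have e₁ := hdef (f (1, j)) (f (2, i))
      have e₂ := hexc (f (0, j)) (f (1, i))
      grind
    · obtain ⟨i₀, i₁, i₂⟩ := columnPerm_true (f := f) ti
      obtain ⟨j₀, j₁, j₂⟩ := columnPerm_true (f := f) tj
      have e₁ := hexc (f (0, i)) (f (0, j))
      have e₂ := hexc (f (1, i)) (f (1, j))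
      have e₃ := hexc (f (1, i)) (f (0, j))
      have e₄ := hexc (f (0, j)) (f (1, i))
      grind
  refine ⟨f, t, ⟨?_, fun i => (hlt i).1, fun i => (hlt i).2, fun i j => ?_⟩,
    fun i j hij => (key i j hij).2.2.2, rfl⟩
  · intro l
    fin_cases l
    · exact hmono
    · exact fun i j hij => (key i j hij).1
    · exact fun i j hij => (key i j hij).2.1
  · rcases lt_trichotomy i j with hij | rfl | hij
    · exact (key i j hij).2.2.1
    · exact iff_of_false (hlt i).1.not_gt (hlt i).2.not_gt
    · exact iff_of_false ((hmono hij).trans (hlt i).1).not_gt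
        (((key j i hij).1).trans (hlt i).2).not_gt

theorem ncard_avStar_pattern321 (n : ℕ) :
    (avStar n pattern321).ncard =
      Nat.card (Σ f : {f : Fin 3 × Fin n ≃ Fin (3 * n) // IsArrangement f},
        {t : Fin n → Bool // IsOrientation f.1 t}) := by
  rw [← Nat.card_coe_set_eq]
  symm
  refine Nat.card_eq_of_bijective
    (fun x => ⟨columnPerm x.1.1 x.2.1, columnPerm_mem_avStar x.1.2 x.2.2⟩) ⟨?_, ?_⟩
  · rintro ⟨⟨f, hf⟩, t, ht⟩ ⟨⟨g, hg⟩, u, hu⟩ e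
    obtain ⟨rfl, rfl⟩ := columnPerm_injective hf hg (congrArg Subtype.val e)
    rfl
  · rintro ⟨π, hπ⟩
    obtain ⟨f, t, hf, ht, rfl⟩ := exists_arrangement hπ
    exact ⟨⟨⟨f, hf⟩, t, ht⟩, rfl⟩

end ThreeCycles

/-! ### Summation over Dyck words -/

theorem theorem321 (n : ℕ) (hn : 1 ≤ n) :
    (ThreeCycles.avStar n ThreeCycles.pattern321).ncard =
      ∑ D : {p : DyckWord // p.semilength = n},
        2 ^ ThreeCycles.h D.1 *
          ∏ i ∈ Finset.Icc 1 (n - 1),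
            (ThreeCycles.r D.1 i + ThreeCycles.s D.1 i).choose (ThreeCycles.r D.1 i) := by
  classical
  open ThreeCycles in
  let dyck : {f : Fin 3 × Fin n ≃ Fin (3 * n) // IsArrangement f} →
      {p : DyckWord // p.semilength = n} := fun f => ⟨f.2.dyckWord, f.2.semilength_dyckWord⟩
  open ThreeCycles in
  have hcard : ∀ f : {f : Fin 3 × Fin n ≃ Fin (3 * n) // IsArrangement f},
      Nat.card {t : Fin n → Bool // IsOrientation f.1 t} = 2 ^ h (dyck f).1 := by
    intro f
    rw [← card_orientations (dyck f).1 (dyck f).2 hn]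
    refine Nat.card_congr (Equiv.subtypeEquivRight fun t => ?_)
    exact forall_congr' fun i => forall_congr' fun j => imp_congr_right fun _ =>
      imp_congr_right fun _ => (f.2.precedes_dyckWord i j).symm
  -- Group the arrangements by Dyck word; the number of orientations is constant on each fibre.
  rw [ThreeCycles.ncard_avStar_pattern321, Nat.card_sigma, ← Finset.sum_fiberwise _ dyck]
  refine Finset.sum_congr rfl fun D _ => ?_
  rw [← ThreeCycles.gapProduct_self D.1 D.2 hn,
    ← (ThreeCycles.shuffles_finite_and_ncard D.1.toList D.1.toList
      D.1.count_U_eq_count_D.symm).2,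
    ← ThreeCycles.card_arrangements D.1 D.2, Nat.mul_comm (2 ^ _)]
  rw [Finset.sum_congr rfl (g := fun _ => 2 ^ ThreeCycles.h D.1), Finset.sum_const, smul_eq_mul]
  · congr 1
    rw [Nat.card_eq_fintype_card, Fintype.card_subtype]
    congr 1
    ext f
    simp [dyck, Subtype.ext_iff]
  · intro f hf
    rw [hcard, (Finset.mem_filter.1 hf).2]
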